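/- Let $m,n\ge 1$ be integers. Let $G(m,1,n)$ be the group with generators $t,s_1,\dots,s_{n-1}$ and relations $s_is_{i+1}s_i=s_{i+1}s_is_{i+1}$; $s_is_j=s_js_i$ for $|i-j|>1$; $s_i^2=1$; $ts_1ts_1=s_1ts_1t$; $ts_i=s_it$ for $i>1$; $t^m=1$. The classical Jucys--Murphy elements of $\mathbb{C}G(m,1,n)$ are defined by $$j_1=t,\quad j_{i+1}=s_ij_is_i,\qquad \tilde j_1=0,\quad \tilde j_{i+1}=s_i\tilde j_is_i+\frac1m\sum_{p=1}^m j_i^{\,p}s_ij_i^{-p}\qquad(1\le i\le n-1).$$ An $m$-partition of $n$ is an $m$-tuple $\lambda^{(m)}=(\lambda_1,\dots,\lambda_m)$ of Young diagrams with $n$ nodes in total. A standard $m$-tableau $X$ of shape $\lambda^{(m)}$ is a bijective placement of $1,\dots,n$ in the nodes such that in each diagram the numbers increase along rows and down columns. Fix a bijection $k\mapsto\xi_k$ from $\{1,\dots,m\}$ to the set of $m$-th roots of unity in $\mathbb{C}$. If $i$ lies in row $r$ and column $s$ of the $k$-th diagram of $X$, put $p(X|i)=\xi_k$ and $c(X|i)=s-r$.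 The content string of $X$ is $\bigl((p(X|i),c(X|i))\bigr)_{i=1,\dots,n}$. Let $V_{\lambda^{(m)}}$ be the complex vector space with basis the vectors $\mathcal X$ attached to the standard $m$-tableaux $X$ of shape $\lambda^{(m)}$. Let $\mathcal X^{s_i}$ be the basis vector attached to the tableau obtained from $X$ by exchanging $i$ and $i+1$ if that tableau is standard, and $\mathcal X^{s_i}=0$ otherwise. Define operators on $V_{\lambda^{(m)}}$ by $$t\,\mathcal X=p(X|1)\,\mathcal X,\qquad s_i\,\mathcal X=\mathcal X^{s_i}\ \text{ if } p(X|i)\ne p(X|i+1),$$ $$s_i\,\mathcal X=\frac{1}{c(X|i+1)-c(X|i)}\,\mathcal X+\Bigl(1+\frac{1}{c(X|i+1)-c(X|i)}\Bigr)\mathcal X^{s_i}\ \text{ if } p(X|i)=p(X|i+1).$$ Then these formulas define representations of $G(m,1,n)$ on the spaces $V_{\lambda^{(m)}}$, and the joint spectrum of the classical Jucys--Murphy elements $j_1,\dots,j_n,\tilde j_1,\dots,\tilde j_n$ in them is simple, in the following sense. 1. For every standard $m$-tableau $X$ and every $i$ one has $j_i\mathcal X=p(X|i)\mathcal X$ and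 $\tilde j_i\mathcal X=c(X|i)\mathcal X$. 2. For every $m$-partition $\lambda^{(m)}$ of $n$, the joint eigenvalue strings occurring in $V_{\lambda^{(m)}}$ are exactly the content strings of the standard $m$-tableaux of shape $\lambda^{(m)}$, and each joint eigenspace in $V_{\lambda^{(m)}}$ is one-dimensional. 3. Distinct standard $m$-tableaux with $n$ nodes, whether of the same or of different shapes, have distinct content strings, that is, give distinct joint eigenvalue strings. -/

import Mathlib

namespace ClassicalJM

noncomputable section

/-- Generators `t, s_1, …, s_{n-1}` of `G(m,1,n)`.  The index `i : Fin (n - 1)` is zero-based: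
`s i` is the generator usually written `s_{i+1}`. -/
inductive Gen (n : ℕ) : Type
  | t : Gen n
  | s : Fin (n - 1) → Gen n

/-- The defining relations of `G(m,1,n)`; `Rel m n u v` means that `u = v` is imposed. -/
inductive Rel (m n : ℕ) : FreeGroup (Gen n) → FreeGroup (Gen n) → Prop
  | braid (i j : Fin (n - 1)) (h : j.val = i.val + 1) :
      Rel m n (.of (.s i) * .of (.s j) * .of (.s i)) (.of (.s j) * .of (.s i) * .of (.s j))
  | comm (i j : Fin (n - 1)) (h : i.val + 1 < j.val ∨ j.val + 1 < i.val) :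
      Rel m n (.of (.s i) * .of (.s j)) (.of (.s j) * .of (.s i))
  | sq (i : Fin (n - 1)) : Rel m n (.of (.s i) ^ 2) 1
  | braidT (i : Fin (n - 1)) (h : i.val = 0) :
      Rel m n (.of .t * .of (.s i) * .of .t * .of (.s i)) (.of (.s i) * .of .t * .of (.s i) * .of .t)
  | commT (i : Fin (n - 1)) (h : 0 < i.val) :
      Rel m n (.of .t * .of (.s i)) (.of (.s i) * .of .t)
  | powT : Rel m n (.of .t ^ m) 1

/-- The complex reflection group `G(m,1,n)`, given by generators and relations. -/
abbrev G (m n : ℕ) : Type :=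
  PresentedGroup {r : FreeGroup (Gen n) | ∃ u v, Rel m n u v ∧ r = u * v⁻¹}

/-- The generator `t` of `G(m,1,n)`. -/
def tG (m n : ℕ) : G m n := PresentedGroup.of Gen.t

/-- The generators `s_1, …, s_{n-1}` of `G(m,1,n)`. -/
def sG (m : ℕ) {n : ℕ} (i : Fin (n - 1)) : G m n := PresentedGroup.of (Gen.s i)

/-- Auxiliary recursion for `jm`: `j_1 = t`, `j_{i+1} = s_i j_i s_i` (zero-based index). -/
def jmAux (m n : ℕ) : (k : ℕ) → k < n → G m n
  | 0, _ => tG m n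
  | k + 1, h =>
      sG m (⟨k, by omega⟩ : Fin (n - 1)) * jmAux m n k (by omega) *
        sG m (⟨k, by omega⟩ : Fin (n - 1))

/-- Auxiliary recursion for `jmTilde` (zero-based index): `j̃_1 = 0` and
`j̃_{i+1} = s_i j̃_i s_i + (1/m) ∑_{p=1}^m j_i^p s_i j_i^{-p}`. -/
def jmTildeAux (m n : ℕ) : (k : ℕ) → k < n → MonoidAlgebra ℂ (G m n)
  | 0, _ => 0
  | k + 1, h =>
      let s : G m n := sG m (⟨k, by omega⟩ : Fin (n - 1))
      let j : G m n := jmAux m n k (by omega)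
      MonoidAlgebra.of ℂ _ s * jmTildeAux m n k (by omega) * MonoidAlgebra.of ℂ _ s +
        (1 / (m : ℂ)) • ∑ p ∈ Finset.Icc 1 m, MonoidAlgebra.of ℂ _ (j ^ p * s * (j ^ p)⁻¹)

/-- The classical Jucys–Murphy elements `j_1, …, j_n` of the group ring of `G(m,1,n)`. -/
def jm (m : ℕ) {n : ℕ} (i : Fin n) : MonoidAlgebra ℂ (G m n) :=
  MonoidAlgebra.of ℂ _ (jmAux m n i.val i.isLt)

/-- The classical Jucys–Murphy elements `j̃_1, …, j̃_n` of the group ring of `G(m,1,n)`. -/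
def jmTilde (m : ℕ) {n : ℕ} (i : Fin n) : MonoidAlgebra ℂ (G m n) :=
  jmTildeAux m n i.val i.isLt

/-- An `m`-partition of length `n`: an `m`-tuple of Young diagrams with `n` nodes in total. -/
structure MPartition (m n : ℕ) where
  diagram : Fin m → YoungDiagram
  card_eq : ∑ k, (diagram k).card = n

variable {m n : ℕ}

/-- Nodes of an `m`-partition: triples (index of the diagram, row, column), rows and columns
being counted from zero. -/
abbrev MPartition.Node (lam : MPartition m n) : Type :=
  {x : Fin m × ℕ × ℕ // x.2 ∈ lam.diagram x.1}

/-- An `m`-tableau of shape `lam`: a placement of the numbers in the nodes, one in each;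
`X i` is the node in which the number `i` is placed. -/
abbrev Tableau (lam : MPartition m n) : Type := Fin n ≃ lam.Node

/-- An `m`-tableau is standard if in every diagram the numbers ascend along rows (to the right)
and along columns (downwards). -/
def IsStandard {lam : MPartition m n} (X : Tableau lam) : Prop :=
  ∀ a b : Fin n, (X a).val.1 = (X b).val.1 →
    (((X a).val.2.1 = (X b).val.2.1 ∧ (X a).val.2.2 < (X b).val.2.2) ∨
      ((X a).val.2.2 = (X b).val.2.2 ∧ (X a).val.2.1 < (X b).val.2.1)) → a < b

/-- Standard `m`-tableaux of shape `lam`. -/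
abbrev StdTableau (lam : MPartition m n) : Type := {X : Tableau lam // IsStandard X}

/-- The tableau `X^π`: the permutation `π` is applied to the numbers occupying the nodes. -/
def Tableau.permute {lam : MPartition m n} (X : Tableau lam) (π : Equiv.Perm (Fin n)) :
    Tableau lam :=
  π.symm.trans X

/-- First content entry `p(X|i)`: the root of unity attached to the diagram containing `i`. -/
def pContent (ξ : Fin m ≃ rootsOfUnity m ℂ) {lam : MPartition m n} (X : Tableau lam)
    (i : Fin n) : ℂ :=
  ((ξ (X i).val.1 : ℂˣ) : ℂ)

/-- Second content entry `c(X|i)`: column minus row of the node containing `i`. -/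
def cContent {lam : MPartition m n} (X : Tableau lam) (i : Fin n) : ℂ :=
  ((X i).val.2.2 : ℂ) - ((X i).val.2.1 : ℂ)

/-- The string of columns `(p(X|i), c(X|i))`, `i = 1, …, n`, associated to a standard tableau. -/
def contentString (ξ : Fin m ≃ rootsOfUnity m ℂ) {lam : MPartition m n} (X : StdTableau lam) :
    Fin n → ℂ × ℂ :=
  fun i => (pContent ξ X.val i, cContent X.val i)

/-- The space of the representation labelled by `lam`: it has a basis indexed by the standard
tableaux of shape `lam`. -/
abbrev V (lam : MPartition m n) : Type := StdTableau lam →₀ ℂ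

/-- The basis vector attached to a standard tableau. -/
def basisVec {lam : MPartition m n} (X : StdTableau lam) : V lam := Finsupp.single X 1

open Classical in
/-- The vector attached to a tableau that need not be standard: zero if it is not. -/
def tabVec {lam : MPartition m n} (X : Tableau lam) : V lam :=
  if h : IsStandard X then basisVec ⟨X, h⟩ else 0

/-- For `i : Fin (n - 1)`, the first of the two neighbouring numbers that `s i` exchanges. -/
def lo (i : Fin (n - 1)) : Fin n := ⟨i.val, by omega⟩

/-- For `i : Fin (n - 1)`, the second of the two neighbouring numbers that `s i` exchanges. -/
def hi (i : Fin (n - 1)) : Fin n := ⟨i.val + 1, by omega⟩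

open Classical in
/-- The value of the operator of `s_i` on a basis vector. -/
def sValue (ξ : Fin m ≃ rootsOfUnity m ℂ) {lam : MPartition m n} (i : Fin (n - 1))
    (X : StdTableau lam) : V lam :=
  let X' : V lam := tabVec (X.val.permute (Equiv.swap (lo i) (hi i)))
  if pContent ξ X.val (lo i) ≠ pContent ξ X.val (hi i) then X'
  else
    (1 / (cContent X.val (hi i) - cContent X.val (lo i))) • basisVec X +
      (1 + 1 / (cContent X.val (hi i) - cContent X.val (lo i))) • X'

/-- The operator by which `s_i` acts on `V lam`. -/
def sOp (ξ : Fin m ≃ rootsOfUnity m ℂ) (lam : MPartition m n) (i : Fin (n - 1)) :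
    Module.End ℂ (V lam) :=
  Finsupp.linearCombination ℂ (sValue ξ i)

/-- The operator by which `t` acts on `V lam`. -/
def tOp (hn : 0 < n) (ξ : Fin m ≃ rootsOfUnity m ℂ) (lam : MPartition m n) :
    Module.End ℂ (V lam) :=
  Finsupp.linearCombination ℂ
    (fun X : StdTableau lam => pContent ξ X.val ⟨0, hn⟩ • basisVec X)

/-- The common eigenspace of all `j_i`, `j̃_i` in a representation, for the string `L` of
eigenvalues `(a_i, ã_i)`. -/
def jointEigenspace {W : Type*} [AddCommGroup W] [Module ℂ W]
    (ρ : Representation ℂ (G m n) W) (L : Fin n → ℂ × ℂ) : Submodule ℂ W :=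
  ⨅ i : Fin n, Module.End.eigenspace (ρ.asAlgebraHom (jm m i)) (L i).1 ⊓
    Module.End.eigenspace (ρ.asAlgebraHom (jmTilde m i)) (L i).2

/-- The joint spectrum of the Jucys–Murphy elements in a representation: the strings of
eigenvalues of common non-zero eigenvectors. -/
def jointSpectrum {W : Type*} [AddCommGroup W] [Module ℂ W]
    (ρ : Representation ℂ (G m n) W) : Set (Fin n → ℂ × ℂ) :=
  {L | ∃ v ∈ jointEigenspace ρ L, v ≠ 0}

end

end ClassicalJM

open ClassicalJM

open ClassicalJM

/-! Let `d` be the inverse axial distance of `i` and `i + 1`, taken to be zero when they lie in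
different diagrams. Both cases of the action of `s_i` then read `X ↦ d X + u X^{s_i}`, where `u` is
`1 + d`, or zero if a tableau involved is not standard (`sOp_tabVec`). The involution relation
reduces to `u u' = 1 - d²`, and the braid relation also uses the rational Yang–Baxter identity for
three consecutive numbers (`IsStandard.invDist_relation`). The denominators do not vanish, because
numbers on one diagonal differ by at least three.

The Jucys–Murphy elements are diagonalized by induction. Conjugation by `s_i` carries `p(X|i)` to
`p(X|i+1)`. The averaged term of the recursion acts as `s_i` within one diagram and as zero
otherwise, since nontrivial `m`-th roots of unity average to zero. This is the correction that
carries `c(X|i)` to `c(X|i+1)`.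

A content string determines its tableau, shape included (`sigma_eq_of_contentString_eq`), so the
joint spectrum of these diagonal operators is simple. -/

namespace ClassicalJM

noncomputable section

variable {m n : ℕ} {lam mu : MPartition m n}

/-! ### Standard tableaux and their contents -/

/-- The node `x` precedes `y` in a row or in a column of the same diagram. -/
def NodeBefore (x y : Fin m × ℕ × ℕ) : Prop :=
  x.1 = y.1 ∧ ((x.2.1 = y.2.1 ∧ x.2.2 < y.2.2) ∨ (x.2.2 = y.2.2 ∧ x.2.1 < y.2.1))

theorem isStandard_iff {X : Tableau lam} :
    IsStandard X ↔ ∀ a b, NodeBefore (X a).val (X b).val → a < b :=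
  ⟨fun h a b hab => h a b hab.1 hab.2, fun h a b h1 h2 => h a b ⟨h1, h2⟩⟩

theorem permute_apply (X : Tableau lam) (π : Equiv.Perm (Fin n)) (a : Fin n) :
    X.permute π a = X (π.symm a) := rfl

theorem permute_permute (X : Tableau lam) (π σ : Equiv.Perm (Fin n)) :
    (X.permute π).permute σ = X.permute (σ * π) := by
  ext1 a
  simp [permute_apply, Equiv.Perm.mul_def]

theorem isStandard_permute {X : Tableau lam} {π : Equiv.Perm (Fin n)} :
    IsStandard (X.permute π) ↔ ∀ a b, NodeBefore (X a).val (X b).val → π a < π b := by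
  rw [isStandard_iff]
  constructor
  · intro h a b hab
    exact h (π a) (π b) (by simpa [permute_apply] using hab)
  · intro h a b hab
    simpa using h (π.symm a) (π.symm b) hab

/-- Every node is occupied by a number. -/
theorem exists_apply_eq (X : Tableau lam) (k : Fin m) (r c : ℕ) (h : (r, c) ∈ lam.diagram k) :
    ∃ a, (X a).val = (k, r, c) :=
  ⟨X.symm ⟨(k, r, c), h⟩, by simp⟩

/-- When row and column both change, the corner node in the row of `a` and the column of `b` belongs
to the diagram, and its number lies between the two. -/
theorem IsStandard.lt_of_le {X : Tableau lam} (hX : IsStandard X) {a b : Fin n}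
    (hk : (X a).val.1 = (X b).val.1) (hr : (X a).val.2.1 ≤ (X b).val.2.1)
    (hc : (X a).val.2.2 ≤ (X b).val.2.2) (hab : a ≠ b) : a < b := by
  rcases hr.eq_or_lt with hr | hr
  · rcases hc.eq_or_lt with hc | hc
    · exact absurd (X.injective (Subtype.ext (Prod.ext hk (Prod.ext hr hc)))) hab
    · exact hX a b hk (Or.inl ⟨hr, hc⟩)
  · rcases hc.eq_or_lt with hc | hc
    · exact hX a b hk (Or.inr ⟨hc, hr⟩)
    · have hmem : ((X a).val.2.1, (X b).val.2.2) ∈ lam.diagram (X b).val.1 :=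
        (lam.diagram (X b).val.1).up_left_mem hr.le le_rfl (X b).property
      obtain ⟨d, hd⟩ := exists_apply_eq X _ _ _ hmem
      have h1 : a < d := hX a d (by rw [hd, hk]) (Or.inl ⟨by rw [hd], by rw [hd]; exact hc⟩)
      have h2 : d < b := hX d b (by rw [hd]) (Or.inr ⟨by rw [hd], by rw [hd]; exact hr⟩)
      exact h1.trans h2

/-- Two numbers on the same diagonal of a diagram differ by at least three. -/
theorem IsStandard.add_three_le {X : Tableau lam} (hX : IsStandard X) {a b : Fin n} (hab : a < b)
    (hk : (X a).val.1 = (X b).val.1)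
    (hc : (X a).val.2.2 + (X b).val.2.1 = (X b).val.2.2 + (X a).val.2.1) :
    a.val + 3 ≤ b.val := by
  have hlt : (X a).val.2.1 < (X b).val.2.1 := by
    by_contra h
    exact (hX.lt_of_le hk.symm (by omega) (by omega) hab.ne').not_gt hab
  have hlt' : (X a).val.2.2 < (X b).val.2.2 := by omega
  have hb := (X b).property
  -- The nodes just right of and just below that of `a` carry two different numbers strictly between
  -- `a` and `b`.
  obtain ⟨d, hd⟩ := exists_apply_eq X (X b).val.1 (X a).val.2.1 ((X a).val.2.2 + 1)
    ((lam.diagram _).up_left_mem hlt.le hlt' hb)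
  obtain ⟨e, he⟩ := exists_apply_eq X (X b).val.1 ((X a).val.2.1 + 1) (X a).val.2.2
    ((lam.diagram _).up_left_mem hlt hlt'.le hb)
  have hde : d ≠ e := by
    rintro rfl
    simp [hd] at he
  have h1 : a < d := hX a d (by rw [hd, hk]) (Or.inl ⟨by rw [hd], by rw [hd]; simp⟩)
  have h2 : a < e := hX a e (by rw [he, hk]) (Or.inr ⟨by rw [he], by rw [he]; simp⟩)
  have h3 : d < b := hX.lt_of_le (by rw [hd]) (by rw [hd]; exact hlt.le)
    (by rw [hd]; simp only; omega) (by rintro rfl; rw [hd] at hlt; simp at hlt)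
  have h4 : e < b := hX.lt_of_le (by rw [he]) (by rw [he]; exact hlt)
    (by rw [he]; simp only; omega) (by rintro rfl; rw [he] at hlt'; simp at hlt')
  have := Fin.val_ne_of_ne hde
  simp only [Fin.lt_def] at h1 h2 h3 h4
  omega

theorem pContent_eq_iff (ξ : Fin m ≃ rootsOfUnity m ℂ) {X : Tableau lam} {Y : Tableau mu}
    {a b : Fin n} : pContent ξ X a = pContent ξ Y b ↔ (X a).val.1 = (Y b).val.1 := by
  simp [pContent, Units.val_inj]

theorem cContent_eq_iff {X : Tableau lam} {Y : Tableau mu} {a b : Fin n} :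
    cContent X a = cContent Y b ↔
      (X a).val.2.2 + (Y b).val.2.1 = (Y b).val.2.2 + (X a).val.2.1 := by
  rw [cContent, cContent, sub_eq_sub_iff_add_eq_add]
  exact_mod_cast Iff.rfl

theorem IsStandard.cContent_ne {X : Tableau lam} (hX : IsStandard X)
    (ξ : Fin m ≃ rootsOfUnity m ℂ) {a b : Fin n} (hab : a < b) (hb : b.val < a.val + 3)
    (hp : pContent ξ X a = pContent ξ X b) : cContent X b - cContent X a ≠ 0 := by
  intro h
  have := hX.add_three_le hab ((pContent_eq_iff ξ).1 hp) (cContent_eq_iff.1 (sub_eq_zero.1 h).symm)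
  omega

/-- Induction on the number `a`: its content fixes a diagonal. If its nodes in the two tableaux
differed, the upper one would hold a number `d < a` in the other tableau; by induction `d` occupies
that node in both, where one of them has `a`. -/
theorem apply_eq_of_contentString_eq (ξ : Fin m ≃ rootsOfUnity m ℂ) {X : StdTableau lam}
    {Y : StdTableau mu} (h : contentString ξ X = contentString ξ Y) (a : Fin n) :
    (X.val a).val = (Y.val a).val := by
  -- Quantified over both shapes, so that it can be applied again with the tableaux interchanged.
  have key : ∀ {lam mu : MPartition m n} {X : Tableau lam} {Y : Tableau mu} (a : Fin n),
      IsStandard Y → (∀ b < a, (X b).val = (Y b).val) → (X a).val.1 = (Y a).val.1 →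
      (X a).val.2.2 + (Y a).val.2.1 = (Y a).val.2.2 + (X a).val.2.1 →
      ¬ (X a).val.2.1 < (Y a).val.2.1 := by
    intro lam mu X Y a hY ih hk hc hlt
    have hlt' : (X a).val.2.2 ≤ (Y a).val.2.2 := by omega
    obtain ⟨d, hd⟩ := exists_apply_eq Y (Y a).val.1 (X a).val.2.1 (X a).val.2.2
      ((mu.diagram _).up_left_mem hlt.le hlt' (Y a).property)
    have hda : d < a := hY.lt_of_le (by rw [hd]) (by rw [hd]; exact hlt.le)
      (by rw [hd]; simp only; omega) (by rintro rfl; rw [hd] at hlt; simp at hlt)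
    have h1 : (X d).val = (X a).val := by
      rw [ih d hda, hd, ← hk]
    exact hda.ne (X.injective (Subtype.ext h1))
  induction a using WellFoundedLT.induction with
  | _ a ih =>
    have hpc := Prod.ext_iff.1 (congrFun h a)
    have hk := (pContent_eq_iff ξ).1 hpc.1
    have hc := cContent_eq_iff.1 hpc.2
    have h1 := key a Y.property (fun b hb => ih b hb) hk hc
    have h2 := key a X.property (fun b hb => (ih b hb).symm) hk.symm hc.symm
    exact Prod.ext hk (Prod.ext (by omega) (by omega))

theorem sigma_eq_of_contentString_eq (ξ : Fin m ≃ rootsOfUnity m ℂ) {X : StdTableau lam}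
    {Y : StdTableau mu} (h : contentString ξ X = contentString ξ Y) :
    (⟨lam, X⟩ : Σ nu : MPartition m n, StdTableau nu) = ⟨mu, Y⟩ := by
  have hXY := apply_eq_of_contentString_eq ξ h
  have hdiag : lam.diagram = mu.diagram := by
    funext k
    ext ⟨r, c⟩
    simp only [YoungDiagram.mem_cells]
    constructor
    · intro hx
      obtain ⟨a, ha⟩ := exists_apply_eq X.val k r c hx
      have := (Y.val a).property
      rwa [← hXY, ha] at this
    · intro hx
      obtain ⟨a, ha⟩ := exists_apply_eq Y.val k r c hx
      have := (X.val a).property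
      rwa [hXY, ha] at this
  have hlm : lam = mu := by
    cases lam; cases mu; cases hdiag; rfl
  subst hlm
  have : X = Y := Subtype.ext (Equiv.ext fun a => Subtype.ext (hXY a))
  rw [this]

/-! ### Exchanging neighbours and the uniform formula for `s_i` -/

/-- The tableau with the two neighbouring numbers `lo i` and `hi i` exchanged. -/
def swapAt (i : Fin (n - 1)) (X : Tableau lam) : Tableau lam :=
  X.permute (Equiv.swap (lo i) (hi i))

theorem swapAt_apply (i : Fin (n - 1)) (X : Tableau lam) (a : Fin n) :
    swapAt i X a = X (Equiv.swap (lo i) (hi i) a) := rfl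

theorem swapAt_swapAt (i : Fin (n - 1)) (X : Tableau lam) : swapAt i (swapAt i X) = X := by
  ext1 a
  simp [swapAt_apply]

theorem lo_ne_hi (i : Fin (n - 1)) : lo i ≠ hi i := by
  simp [lo, hi]

theorem lo_lt_hi (i : Fin (n - 1)) : lo i < hi i := by
  simp [lo, hi, Fin.lt_def]

theorem pContent_swapAt (ξ : Fin m ≃ rootsOfUnity m ℂ) (i : Fin (n - 1)) (X : Tableau lam)
    (a : Fin n) : pContent ξ (swapAt i X) a = pContent ξ X (Equiv.swap (lo i) (hi i) a) := rfl

theorem cContent_swapAt (i : Fin (n - 1)) (X : Tableau lam) (a : Fin n) :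
    cContent (swapAt i X) a = cContent X (Equiv.swap (lo i) (hi i) a) := rfl

/-- The inverse axial distance of two numbers in the same diagram, zero for different diagrams. -/
def invDist (ξ : Fin m ≃ rootsOfUnity m ℂ) (X : Tableau lam) (a b : Fin n) : ℂ :=
  open Classical in
  if pContent ξ X a = pContent ξ X b then 1 / (cContent X b - cContent X a) else 0

theorem invDist_comm (ξ : Fin m ≃ rootsOfUnity m ℂ) (X : Tableau lam) (a b : Fin n) :
    invDist ξ X b a = - invDist ξ X a b := by
  unfold invDist
  by_cases h : pContent ξ X a = pContent ξ X b
  · rw [if_pos h, if_pos h.symm, ← neg_sub (cContent X b), div_neg]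
  · rw [if_neg h, if_neg (Ne.symm h), neg_zero]

theorem invDist_swapAt (ξ : Fin m ≃ rootsOfUnity m ℂ) (i : Fin (n - 1)) (X : Tableau lam)
    (a b : Fin n) : invDist ξ (swapAt i X) a b =
      invDist ξ X (Equiv.swap (lo i) (hi i) a) (Equiv.swap (lo i) (hi i) b) := rfl

/-- The coefficient of the exchanged tableau in the action of `s_i`. -/
def stepCoeff (ξ : Fin m ≃ rootsOfUnity m ℂ) (i : Fin (n - 1)) (X : Tableau lam) : ℂ :=
  open Classical in
  if IsStandard X ∧ IsStandard (swapAt i X) then 1 + invDist ξ X (lo i) (hi i) else 0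

theorem stepCoeff_of_isStandard (ξ : Fin m ≃ rootsOfUnity m ℂ) {i : Fin (n - 1)} {X : Tableau lam}
    (h : IsStandard X) (h' : IsStandard (swapAt i X)) :
    stepCoeff ξ i X = 1 + invDist ξ X (lo i) (hi i) :=
  if_pos ⟨h, h'⟩

theorem stepCoeff_of_not (ξ : Fin m ≃ rootsOfUnity m ℂ) {i : Fin (n - 1)} {X : Tableau lam}
    (h : ¬ IsStandard (swapAt i X)) : stepCoeff ξ i X = 0 :=
  if_neg fun h' => h h'.2

theorem tabVec_of_not {X : Tableau lam} (h : ¬ IsStandard X) : tabVec X = 0 := dif_neg h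

theorem tabVec_of_isStandard {X : Tableau lam} (h : IsStandard X) :
    tabVec X = basisVec ⟨X, h⟩ := dif_pos h

/-- If exchanging two neighbouring numbers destroys standardness, they are in adjacent nodes. -/
theorem IsStandard.nodeBefore_of_not {X : Tableau lam} (hX : IsStandard X) {i : Fin (n - 1)}
    (h : ¬ IsStandard (swapAt i X)) : NodeBefore (X (lo i)).val (X (hi i)).val := by
  by_contra hne
  refine h (isStandard_permute.2 fun a b hab => ?_)
  have hlt := isStandard_iff.1 hX a b hab
  by_cases ha : a = lo i
  · subst ha
    have hb : b ≠ hi i := by rintro rfl; exact hne hab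
    rw [Equiv.swap_apply_left, Equiv.swap_apply_of_ne_of_ne hlt.ne' hb]
    have := Fin.val_ne_of_ne hb
    simp only [Fin.lt_def, lo, hi] at *
    omega
  · simp only [Equiv.swap_apply_def]
    simp only [Fin.lt_def, Fin.ext_iff, lo, hi] at *
    split_ifs <;> simp <;> omega

/-- The two numbers share a row or a column, and a node between theirs would need a number between
two consecutive ones. So the nodes are adjacent and the axial distance is `±1`. -/
theorem IsStandard.invDist_sq {X : Tableau lam} (hX : IsStandard X)
    (ξ : Fin m ≃ rootsOfUnity m ℂ) {i : Fin (n - 1)} (h : ¬ IsStandard (swapAt i X)) :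
    invDist ξ X (lo i) (hi i) ^ 2 = 1 := by
  have hb := hX.nodeBefore_of_not h
  have hlh : (hi i).val = (lo i).val + 1 := rfl
  have hp : pContent ξ X (lo i) = pContent ξ X (hi i) := (pContent_eq_iff ξ).2 hb.1
  rw [invDist, if_pos hp]
  rcases hb.2 with ⟨hr, hc⟩ | ⟨hc, hr⟩
  · have : (X (hi i)).val.2.2 = (X (lo i)).val.2.2 + 1 := by
      by_contra hne
      obtain ⟨d, hd⟩ := exists_apply_eq X (X (hi i)).val.1 (X (hi i)).val.2.1
        ((X (lo i)).val.2.2 + 1) ((lam.diagram _).up_left_mem le_rfl hc (X (hi i)).property)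
      have h1 : lo i < d := hX _ d (by rw [hd, hb.1]) (Or.inl ⟨by rw [hd, hr], by rw [hd]; simp⟩)
      have h2 : d < hi i := hX d _ (by rw [hd])
        (Or.inl ⟨by rw [hd], by rw [hd]; simp only; omega⟩)
      simp only [Fin.lt_def] at h1 h2
      omega
    simp [cContent, this, hr]
  · have : (X (hi i)).val.2.1 = (X (lo i)).val.2.1 + 1 := by
      by_contra hne
      obtain ⟨d, hd⟩ := exists_apply_eq X (X (hi i)).val.1 ((X (lo i)).val.2.1 + 1)
        (X (hi i)).val.2.2 ((lam.diagram _).up_left_mem hr le_rfl (X (hi i)).property)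
      have h1 : lo i < d := hX _ d (by rw [hd, hb.1]) (Or.inr ⟨by rw [hd, hc], by rw [hd]; simp⟩)
      have h2 : d < hi i := hX d _ (by rw [hd])
        (Or.inr ⟨by rw [hd], by rw [hd]; simp only; omega⟩)
      simp only [Fin.lt_def] at h1 h2
      omega
    have e : cContent X (hi i) - cContent X (lo i) = -1 := by
      simp only [cContent, this, hc]
      push_cast
      ring
    rw [e]
    norm_num

/-- Valid for nonstandard tableaux too, so words in the generators expand by rewriting, without case
distinctions. -/
theorem sOp_tabVec (ξ : Fin m ≃ rootsOfUnity m ℂ) (i : Fin (n - 1)) (X : Tableau lam) :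
    sOp ξ lam i (tabVec X) = invDist ξ X (lo i) (hi i) • tabVec X +
      stepCoeff ξ i X • tabVec (swapAt i X) := by
  by_cases hX : IsStandard X
  · rw [tabVec_of_isStandard hX, basisVec, sOp, Finsupp.linearCombination_single, one_smul,
      sValue]
    simp only
    change (if _ then tabVec (swapAt i X) else _ + _ • tabVec (swapAt i X)) = _
    by_cases hs : IsStandard (swapAt i X)
    · rw [stepCoeff_of_isStandard ξ hX hs, invDist]
      by_cases hp : pContent ξ X (lo i) = pContent ξ X (hi i)
      · simp [hp, basisVec]
      · simp [hp]
    · have hp : pContent ξ X (lo i) = pContent ξ X (hi i) :=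
        (pContent_eq_iff ξ).2 (hX.nodeBefore_of_not hs).1
      simp [tabVec_of_not hs, hp, invDist, basisVec]
  · simp [tabVec_of_not hX, stepCoeff, hX]

theorem tOp_tabVec (hn : 0 < n) (ξ : Fin m ≃ rootsOfUnity m ℂ) (X : Tableau lam) :
    tOp hn ξ lam (tabVec X) = pContent ξ X ⟨0, hn⟩ • tabVec X := by
  by_cases hX : IsStandard X
  · simp [tabVec_of_isStandard hX, basisVec, tOp, Finsupp.linearCombination_single]
  · simp [tabVec_of_not hX]

/-- If the exchanged tableau is not standard, both sides vanish, since the inverse distance is then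
`±1`. -/
theorem stepCoeff_mul_stepCoeff (ξ : Fin m ≃ rootsOfUnity m ℂ) (i : Fin (n - 1))
    {X : Tableau lam} (hX : IsStandard X) :
    stepCoeff ξ i X * stepCoeff ξ i (swapAt i X) = 1 - invDist ξ X (lo i) (hi i) ^ 2 := by
  by_cases hs : IsStandard (swapAt i X)
  · rw [stepCoeff_of_isStandard ξ hX hs,
      stepCoeff_of_isStandard ξ hs (by rwa [swapAt_swapAt]), invDist_swapAt,
      Equiv.swap_apply_left, Equiv.swap_apply_right, invDist_comm]
    ring
  · rw [stepCoeff_of_not ξ hs, hX.invDist_sq ξ hs]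
    ring

theorem end_ext {A B : Module.End ℂ (V lam)}
    (h : ∀ X : Tableau lam, IsStandard X → A (tabVec X) = B (tabVec X)) : A = B := by
  refine Finsupp.lhom_ext' fun X => LinearMap.ext_ring ?_
  have := h X.val X.property
  rwa [tabVec_of_isStandard X.property] at this

/-! ### Standardness along words of exchanges -/

theorem isStandard_swapAt_iff {i : Fin (n - 1)} {X : Tableau lam} : IsStandard (swapAt i X) ↔
    ∀ a b, NodeBefore (X a).val (X b).val →
      Equiv.swap (lo i) (hi i) a < Equiv.swap (lo i) (hi i) b :=
  isStandard_permute

theorem isStandard_swapAt_swapAt_iff {i j : Fin (n - 1)} {X : Tableau lam} :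
    IsStandard (swapAt j (swapAt i X)) ↔ ∀ a b, NodeBefore (X a).val (X b).val →
      Equiv.swap (lo j) (hi j) (Equiv.swap (lo i) (hi i) a) <
        Equiv.swap (lo j) (hi j) (Equiv.swap (lo i) (hi i) b) := by
  rw [swapAt, swapAt, permute_permute, isStandard_permute]
  rfl

theorem isStandard_swapAt_swapAt_swapAt_iff {i j k : Fin (n - 1)} {X : Tableau lam} :
    IsStandard (swapAt k (swapAt j (swapAt i X))) ↔ ∀ a b, NodeBefore (X a).val (X b).val →
      Equiv.swap (lo k) (hi k) (Equiv.swap (lo j) (hi j) (Equiv.swap (lo i) (hi i) a)) <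
        Equiv.swap (lo k) (hi k)
          (Equiv.swap (lo j) (hi j) (Equiv.swap (lo i) (hi i) b)) := by
  rw [swapAt, swapAt, swapAt, permute_permute, permute_permute, isStandard_permute]
  rfl

theorem swapAt_comm {i j : Fin (n - 1)} (h : i.val + 1 < j.val ∨ j.val + 1 < i.val)
    (X : Tableau lam) : swapAt i (swapAt j X) = swapAt j (swapAt i X) := by
  ext1 a
  simp only [swapAt_apply]
  congr 1
  simp only [Equiv.swap_apply_def, Fin.ext_iff, lo, hi]
  grind

theorem swapAt_braid {i j : Fin (n - 1)} (h : j.val = i.val + 1) (X : Tableau lam) :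
    swapAt i (swapAt j (swapAt i X)) = swapAt j (swapAt i (swapAt j X)) := by
  ext1 a
  simp only [swapAt_apply]
  congr 1
  simp only [Equiv.swap_apply_def, Fin.ext_iff, lo, hi]
  grind

theorem val_swap_lo_hi (i : Fin (n - 1)) (a : Fin n) :
    (a.val = i.val ∧ (Equiv.swap (lo i) (hi i) a).val = i.val + 1) ∨
    (a.val = i.val + 1 ∧ (Equiv.swap (lo i) (hi i) a).val = i.val) ∨
    (a.val ≠ i.val ∧ a.val ≠ i.val + 1 ∧ (Equiv.swap (lo i) (hi i) a).val = a.val) := by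
  simp only [Equiv.swap_apply_def, Fin.ext_iff, lo, hi]
  split_ifs <;> simp_all

/-- An ordered pair inverted by `s_i` must be `(i, i + 1)`; the distant `s_j` fixes both entries, so
the pair would stay inverted. -/
theorem isStandard_of_comm {i j : Fin (n - 1)} (h : i.val + 1 < j.val ∨ j.val + 1 < i.val)
    {X : Tableau lam} (hX : IsStandard X) (hij : IsStandard (swapAt i (swapAt j X))) :
    IsStandard (swapAt i X) := by
  rw [isStandard_swapAt_swapAt_iff] at hij
  rw [isStandard_swapAt_iff]
  intro a b hab
  have h1 := isStandard_iff.1 hX a b hab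
  have h2 := hij a b hab
  have := val_swap_lo_hi i a
  have := val_swap_lo_hi i b
  have := val_swap_lo_hi j a
  have := val_swap_lo_hi j b
  have := val_swap_lo_hi i (Equiv.swap (lo j) (hi j) a)
  have := val_swap_lo_hi i (Equiv.swap (lo j) (hi j) b)
  rw [Fin.lt_def] at *
  omega

/-- The word `s_i s_j s_i` is reduced, so a pair inverted at an intermediate stage is still inverted
at the end. -/
theorem isStandard_of_braid {i j : Fin (n - 1)} (h : j.val = i.val + 1 ∨ i.val = j.val + 1)
    {X : Tableau lam} (hX : IsStandard X)
    (hw : IsStandard (swapAt i (swapAt j (swapAt i X)))) :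
    IsStandard (swapAt i X) ∧ IsStandard (swapAt j (swapAt i X)) := by
  rw [isStandard_swapAt_swapAt_swapAt_iff] at hw
  rw [isStandard_swapAt_swapAt_iff, isStandard_swapAt_iff]
  suffices H : ∀ a b, NodeBefore (X a).val (X b).val →
      Equiv.swap (lo i) (hi i) a < Equiv.swap (lo i) (hi i) b ∧
      Equiv.swap (lo j) (hi j) (Equiv.swap (lo i) (hi i) a) <
        Equiv.swap (lo j) (hi j) (Equiv.swap (lo i) (hi i) b) from
    ⟨fun a b hab => (H a b hab).1, fun a b hab => (H a b hab).2⟩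
  intro a b hab
  have h1 := isStandard_iff.1 hX a b hab
  have h2 := hw a b hab
  have := val_swap_lo_hi i a
  have := val_swap_lo_hi i b
  have := val_swap_lo_hi j (Equiv.swap (lo i) (hi i) a)
  have := val_swap_lo_hi j (Equiv.swap (lo i) (hi i) b)
  have := val_swap_lo_hi i (Equiv.swap (lo j) (hi j) (Equiv.swap (lo i) (hi i) a))
  have := val_swap_lo_hi i (Equiv.swap (lo j) (hi j) (Equiv.swap (lo i) (hi i) b))
  rw [Fin.lt_def] at *
  rw [Fin.lt_def]
  rcases h with h | h <;> omega

/-! ### The defining relations -/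

theorem sOp_mul_self (ξ : Fin m ≃ rootsOfUnity m ℂ) (i : Fin (n - 1)) :
    sOp ξ lam i * sOp ξ lam i = 1 := by
  refine end_ext fun X hX => ?_
  have hu := stepCoeff_mul_stepCoeff ξ i hX
  simp only [Module.End.mul_apply, sOp_tabVec, map_add, map_smul, swapAt_swapAt, invDist_swapAt,
    Equiv.swap_apply_left, Equiv.swap_apply_right, Module.End.one_apply,
    invDist_comm ξ X (lo i) (hi i)]
  linear_combination (norm := module) hu • tabVec X

theorem swap_apply_of_far {i j : Fin (n - 1)} (h : i.val + 1 < j.val ∨ j.val + 1 < i.val) :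
    Equiv.swap (lo i) (hi i) (lo j) = lo j ∧ Equiv.swap (lo i) (hi i) (hi j) = hi j := by
  constructor <;> apply Equiv.swap_apply_of_ne_of_ne <;>
    simp only [ne_eq, Fin.ext_iff, lo, hi] <;> omega

theorem stepCoeff_comm (ξ : Fin m ≃ rootsOfUnity m ℂ) {i j : Fin (n - 1)}
    (h : i.val + 1 < j.val ∨ j.val + 1 < i.val) {X : Tableau lam} (hX : IsStandard X)
    (hij : IsStandard (swapAt i (swapAt j X))) :
    stepCoeff ξ j X * stepCoeff ξ i (swapAt j X) =
      (1 + invDist ξ X (lo j) (hi j)) * (1 + invDist ξ X (lo i) (hi i)) := by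
  have hj : IsStandard (swapAt j X) :=
    isStandard_of_comm h.symm hX (by rwa [swapAt_comm h.symm])
  rw [stepCoeff_of_isStandard ξ hX hj, stepCoeff_of_isStandard ξ hj hij, invDist_swapAt,
    (swap_apply_of_far h.symm).1, (swap_apply_of_far h.symm).2]

theorem sOp_comm (ξ : Fin m ≃ rootsOfUnity m ℂ) {i j : Fin (n - 1)}
    (h : i.val + 1 < j.val ∨ j.val + 1 < i.val) :
    sOp ξ lam i * sOp ξ lam j = sOp ξ lam j * sOp ξ lam i := by
  refine end_ext fun X hX => ?_
  have hu : (stepCoeff ξ j X * stepCoeff ξ i (swapAt j X)) • tabVec (swapAt i (swapAt j X)) =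
      (stepCoeff ξ i X * stepCoeff ξ j (swapAt i X)) • tabVec (swapAt i (swapAt j X)) := by
    by_cases hij : IsStandard (swapAt i (swapAt j X))
    · rw [stepCoeff_comm ξ h hX hij,
        stepCoeff_comm ξ h.symm hX (by rwa [swapAt_comm h.symm]), mul_comm]
    · simp [tabVec_of_not hij]
  simp only [Module.End.mul_apply, sOp_tabVec, map_add, map_smul, invDist_swapAt,
    swap_apply_of_far h, swap_apply_of_far h.symm, swapAt_comm h.symm]
  linear_combination (norm := module) hu

/-- Within one diagram this is `(1/(x+y)) (1/x + 1/y) = 1/(xy)`, with `x`, `y` the successive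
content differences. In the other cases both sides vanish. -/
theorem IsStandard.invDist_relation {X : Tableau lam} (hX : IsStandard X)
    (ξ : Fin m ≃ rootsOfUnity m ℂ) {a b c : Fin n} (hab : b.val = a.val + 1)
    (hbc : c.val = b.val + 1) :
    invDist ξ X a c * (invDist ξ X a b + invDist ξ X b c) = invDist ξ X a b * invDist ξ X b c := by
  unfold invDist
  by_cases h1 : pContent ξ X a = pContent ξ X b
  · by_cases h2 : pContent ξ X b = pContent ξ X c
    · rw [if_pos h1, if_pos h2, if_pos (h1.trans h2)]
      have e1 := hX.cContent_ne ξ (a := a) (b := b) (Fin.lt_def.2 (by omega)) (by omega) h1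
      have e2 := hX.cContent_ne ξ (a := b) (b := c) (Fin.lt_def.2 (by omega)) (by omega) h2
      have e3 := hX.cContent_ne ξ (a := a) (b := c) (Fin.lt_def.2 (by omega)) (by omega)
        (h1.trans h2)
      field_simp
      ring
    · rw [if_neg h2, if_neg (fun h => h2 (h1.symm.trans h))]
      simp
  · by_cases h2 : pContent ξ X b = pContent ξ X c
    · rw [if_neg h1, if_neg (fun h => h1 (h.trans h2.symm))]
      simp
    · rw [if_neg h1, if_neg h2]
      simp

theorem stepCoeff_braid (ξ : Fin m ≃ rootsOfUnity m ℂ) {i j : Fin (n - 1)}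
    (h : j.val = i.val + 1 ∨ i.val = j.val + 1) {X : Tableau lam} (hX : IsStandard X)
    (hw : IsStandard (swapAt i (swapAt j (swapAt i X)))) :
    stepCoeff ξ i X * stepCoeff ξ j (swapAt i X) * stepCoeff ξ i (swapAt j (swapAt i X)) =
      (1 + invDist ξ X (lo i) (hi i)) *
      (1 + invDist ξ X (Equiv.swap (lo i) (hi i) (lo j)) (Equiv.swap (lo i) (hi i) (hi j))) *
      (1 + invDist ξ X (Equiv.swap (lo i) (hi i) (Equiv.swap (lo j) (hi j) (lo i)))
        (Equiv.swap (lo i) (hi i) (Equiv.swap (lo j) (hi j) (hi i)))) := by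
  obtain ⟨h1, h2⟩ := isStandard_of_braid h hX hw
  rw [stepCoeff_of_isStandard ξ hX h1, stepCoeff_of_isStandard ξ h1 h2,
    stepCoeff_of_isStandard ξ h2 hw]
  rfl

theorem sOp_braid (ξ : Fin m ≃ rootsOfUnity m ℂ) {i j : Fin (n - 1)} (h : j.val = i.val + 1) :
    sOp ξ lam i * sOp ξ lam j * sOp ξ lam i = sOp ξ lam j * sOp ξ lam i * sOp ξ lam j := by
  refine end_ext fun X hX => ?_
  have hij : hi i = lo j := Fin.ext h.symm
  have hne1 : lo i ≠ lo j := by simp only [ne_eq, Fin.ext_iff, lo]; omega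
  have hne2 : lo i ≠ hi j := by simp only [ne_eq, Fin.ext_iff, lo, hi]; omega
  have hne3 : lo j ≠ hi j := lo_ne_hi j
  have r1 : Equiv.swap (lo i) (lo j) (hi j) = hi j :=
    Equiv.swap_apply_of_ne_of_ne hne2.symm hne3.symm
  have r2 : Equiv.swap (lo j) (hi j) (lo i) = lo i := Equiv.swap_apply_of_ne_of_ne hne1 hne2
  have hrel := hX.invDist_relation ξ (a := lo i) (b := lo j) (c := hi j) h rfl
  have hu : (stepCoeff ξ i X * stepCoeff ξ j (swapAt i X) *
        stepCoeff ξ i (swapAt j (swapAt i X))) • tabVec (swapAt i (swapAt j (swapAt i X))) =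
      (stepCoeff ξ j X * stepCoeff ξ i (swapAt j X) *
        stepCoeff ξ j (swapAt i (swapAt j X))) • tabVec (swapAt i (swapAt j (swapAt i X))) := by
    by_cases hw : IsStandard (swapAt i (swapAt j (swapAt i X)))
    · rw [stepCoeff_braid ξ (Or.inl h) hX hw,
        stepCoeff_braid ξ (Or.inr h) hX (by rwa [← swapAt_braid h])]
      simp only [hij, r1, r2, Equiv.swap_apply_left, Equiv.swap_apply_right]
      congr 1
      ring
    · simp [tabVec_of_not hw]
  have hi2 := stepCoeff_mul_stepCoeff ξ i hX
  have hj2 := stepCoeff_mul_stepCoeff ξ j hX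
  simp only [Module.End.mul_apply, sOp_tabVec, map_add, map_smul, swapAt_swapAt, invDist_swapAt,
    hij, r1, r2, Equiv.swap_apply_left, Equiv.swap_apply_right, ← swapAt_braid h] at hi2 hj2 ⊢
  rw [invDist_comm ξ X (lo i) (lo j), invDist_comm ξ X (lo j) (hi j)]
  generalize invDist ξ X (lo i) (lo j) = x at *
  generalize invDist ξ X (lo j) (hi j) = y at *
  generalize invDist ξ X (lo i) (hi j) = z at *
  -- Coefficients are compared on the orbit of `X` under the two exchanges. At `X` the difference is
  -- `(x - y)(xy - z(x + y))` once the step products are replaced; at the single exchanges `hrel`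
  -- suffices, and `hu` treats the longest word.
  linear_combination (norm := module) hu + (z * hi2) • tabVec X - (z * hj2) • tabVec X
    - ((x - y) * hrel) • tabVec X - (stepCoeff ξ i X * hrel) • tabVec (swapAt i X)
    + (stepCoeff ξ j X * hrel) • tabVec (swapAt j X)

/-- Conjugation by `s_i` of an operator that is diagonal with entries `p(X|i)`. -/
theorem sOp_conj_pContent (ξ : Fin m ≃ rootsOfUnity m ℂ) (i : Fin (n - 1))
    {A : Module.End ℂ (V lam)}
    (hA : ∀ X : Tableau lam, A (tabVec X) = pContent ξ X (lo i) • tabVec X) (X : Tableau lam) :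
    (sOp ξ lam i * A * sOp ξ lam i) (tabVec X) = pContent ξ X (hi i) • tabVec X := by
  by_cases hX : IsStandard X
  swap
  · simp [tabVec_of_not hX]
  have hs : sOp ξ lam i (sOp ξ lam i (tabVec X)) = tabVec X := by
    rw [← Module.End.mul_apply, sOp_mul_self, Module.End.one_apply]
  -- The image under `s_i` is an eigenvector of `A`: either the two roots of unity agree, or the
  -- diagonal coefficient is zero.
  have hA' : A (sOp ξ lam i (tabVec X)) = pContent ξ X (hi i) • sOp ξ lam i (tabVec X) := by
    rw [sOp_tabVec, map_add, map_smul, map_smul, hA, hA, pContent_swapAt, Equiv.swap_apply_left]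
    by_cases hp : pContent ξ X (lo i) = pContent ξ X (hi i)
    · rw [hp]
      module
    · rw [invDist, if_neg hp]
      module
  rw [Module.End.mul_apply, Module.End.mul_apply, hA', map_smul, hs]

/-- The relation says that `t` commutes with `s_1 t s_1`, and both are diagonal in the tableau
basis. -/
theorem tOp_braid (hn : 0 < n) (ξ : Fin m ≃ rootsOfUnity m ℂ) {i : Fin (n - 1)}
    (h : i.val = 0) :
    tOp hn ξ lam * sOp ξ lam i * tOp hn ξ lam * sOp ξ lam i =
      sOp ξ lam i * tOp hn ξ lam * sOp ξ lam i * tOp hn ξ lam := by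
  have h0 : lo i = ⟨0, hn⟩ := Fin.ext h
  have ht := tOp_tabVec (lam := lam) hn ξ
  have hc := sOp_conj_pContent ξ i (lam := lam) (by rw [h0]; exact ht)
  have : Commute (tOp hn ξ lam) (sOp ξ lam i * tOp hn ξ lam * sOp ξ lam i) := by
    refine end_ext fun X _ => ?_
    rw [Module.End.mul_apply (tOp hn ξ lam) (_ * _ * _),
      Module.End.mul_apply (_ * _ * _) (tOp hn ξ lam), ht, hc, map_smul, map_smul, ht, hc, smul_comm]
  simpa only [mul_assoc] using this.eq

theorem tOp_comm (hn : 0 < n) (ξ : Fin m ≃ rootsOfUnity m ℂ) {i : Fin (n - 1)}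
    (h : 0 < i.val) : tOp hn ξ lam * sOp ξ lam i = sOp ξ lam i * tOp hn ξ lam := by
  refine end_ext fun X _ => ?_
  have h0 : Equiv.swap (lo i) (hi i) ⟨0, hn⟩ = ⟨0, hn⟩ := by
    apply Equiv.swap_apply_of_ne_of_ne <;> simp only [ne_eq, Fin.ext_iff, lo, hi] <;> omega
  simp only [Module.End.mul_apply, tOp_tabVec, sOp_tabVec, map_add, map_smul, pContent_swapAt, h0]
  module

theorem pContent_pow (ξ : Fin m ≃ rootsOfUnity m ℂ) (X : Tableau lam) (a : Fin n) :
    pContent ξ X a ^ m = 1 :=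
  (mem_rootsOfUnity' m _).1 (ξ (X a).val.1).property

theorem pow_tabVec {A : Module.End ℂ (V lam)} {X : Tableau lam} {c : ℂ}
    (h : A (tabVec X) = c • tabVec X) (k : ℕ) : (A ^ k) (tabVec X) = c ^ k • tabVec X := by
  induction k with
  | zero => simp
  | succ k ih => rw [pow_succ, Module.End.mul_apply, h, map_smul, ih, smul_smul, pow_succ']

theorem tOp_pow (hn : 0 < n) (ξ : Fin m ≃ rootsOfUnity m ℂ) : tOp hn ξ lam ^ m = 1 := by
  refine end_ext fun X _ => ?_
  rw [pow_tabVec (tOp_tabVec hn ξ X), pContent_pow, one_smul, Module.End.one_apply]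

/-! ### The representation -/

/-- The images of the generators, as invertible operators. -/
def genUnit (hm : 0 < m) (hn : 0 < n) (ξ : Fin m ≃ rootsOfUnity m ℂ) (lam : MPartition m n) :
    Gen n → (Module.End ℂ (V lam))ˣ
  | .t => Units.ofPowEqOne (tOp hn ξ lam) m (tOp_pow hn ξ) hm.ne'
  | .s i => ⟨sOp ξ lam i, sOp ξ lam i, sOp_mul_self ξ i, sOp_mul_self ξ i⟩

theorem val_genUnit_t (hm : 0 < m) (hn : 0 < n) (ξ : Fin m ≃ rootsOfUnity m ℂ) :
    (genUnit hm hn ξ lam .t : Module.End ℂ (V lam)) = tOp hn ξ lam := rfl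

theorem val_genUnit_s (hm : 0 < m) (hn : 0 < n) (ξ : Fin m ≃ rootsOfUnity m ℂ)
    (i : Fin (n - 1)) : (genUnit hm hn ξ lam (.s i) : Module.End ℂ (V lam)) = sOp ξ lam i := rfl

theorem lift_genUnit_eq_one (hm : 0 < m) (hn : 0 < n) (ξ : Fin m ≃ rootsOfUnity m ℂ) :
    ∀ r ∈ {r : FreeGroup (Gen n) | ∃ u v, Rel m n u v ∧ r = u * v⁻¹},
      FreeGroup.lift (genUnit hm hn ξ lam) r = 1 := by
  rintro r ⟨u, v, huv, rfl⟩
  rw [map_mul, map_inv, mul_inv_eq_one]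
  cases huv <;> ext1 <;>
    simp only [map_mul, map_pow, map_one, FreeGroup.lift_apply_of, Units.val_mul,
      Units.val_pow_eq_pow_val, Units.val_one, val_genUnit_t, val_genUnit_s]
  case braid i j h => exact sOp_braid ξ h
  case comm i j h => exact sOp_comm ξ h
  case sq i => rw [pow_two, sOp_mul_self]
  case braidT i h => exact tOp_braid hn ξ h
  case commT i h => exact tOp_comm hn ξ h
  case powT => exact tOp_pow hn ξ

/-- The representation of `G(m,1,n)` on the space `V lam`. -/
def seminormalRep (hm : 0 < m) (hn : 0 < n) (ξ : Fin m ≃ rootsOfUnity m ℂ)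
    (lam : MPartition m n) : Representation ℂ (G m n) (V lam) :=
  (Units.coeHom _).comp (PresentedGroup.toGroup (lift_genUnit_eq_one (lam := lam) hm hn ξ))

theorem seminormalRep_tG (hm : 0 < m) (hn : 0 < n) (ξ : Fin m ≃ rootsOfUnity m ℂ) :
    seminormalRep hm hn ξ lam (tG m n) = tOp hn ξ lam := by
  simp [seminormalRep, tG, PresentedGroup.toGroup.of, val_genUnit_t]

theorem seminormalRep_sG (hm : 0 < m) (hn : 0 < n) (ξ : Fin m ≃ rootsOfUnity m ℂ)
    (i : Fin (n - 1)) : seminormalRep hm hn ξ lam (sG m i) = sOp ξ lam i := by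
  simp [seminormalRep, sG, PresentedGroup.toGroup.of, val_genUnit_s]

/-! ### Eigenvalues of the Jucys–Murphy elements -/

theorem pContent_ne_zero (ξ : Fin m ≃ rootsOfUnity m ℂ) (X : Tableau lam) (a : Fin n) :
    pContent ξ X a ≠ 0 := Units.ne_zero _

theorem seminormalRep_jmAux (hm : 0 < m) (hn : 0 < n) (ξ : Fin m ≃ rootsOfUnity m ℂ) (k : ℕ)
    (hk : k < n) (X : Tableau lam) :
    seminormalRep hm hn ξ lam (jmAux m n k hk) (tabVec X) = pContent ξ X ⟨k, hk⟩ • tabVec X := by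
  induction k generalizing X with
  | zero => rw [jmAux, seminormalRep_tG, tOp_tabVec]
  | succ k ih =>
    rw [jmAux, map_mul, map_mul, seminormalRep_sG]
    exact sOp_conj_pContent ξ ⟨k, by omega⟩ (ih (by omega)) X

theorem rep_inv_apply {H W : Type*} [Group H] [AddCommGroup W] [Module ℂ W]
    (ρ : Representation ℂ H W) {g : H} {v : W} {c : ℂ} (hc : c ≠ 0) (h : ρ g v = c • v) :
    ρ g⁻¹ v = c⁻¹ • v := by
  have h1 : ρ g⁻¹ (ρ g v) = v := by
    rw [← Module.End.mul_apply, ← map_mul, inv_mul_cancel, map_one, Module.End.one_apply]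
  rw [h, map_smul] at h1
  rw [← h1, smul_smul, inv_mul_cancel₀ hc, one_smul, h1]

theorem sum_Icc_pow_eq_zero {K : Type*} [Field K] {q : K} {m : ℕ} (hq : q ^ m = 1) (h1 : q ≠ 1) :
    ∑ p ∈ Finset.Icc 1 m, q ^ p = 0 := by
  have h : (∑ p ∈ Finset.Ico 1 (m + 1), q ^ p) * (q - 1) = q ^ (m + 1) - q ^ 1 :=
    geom_sum_Ico_mul q (by omega)
  rw [pow_succ, hq, one_mul, pow_one, sub_self] at h
  exact (mul_eq_zero.1 h).resolve_right (sub_ne_zero.2 h1)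

/-- The average of the conjugates of `s_i` by the powers of `j_i` acts as `s_i` when `i` and
`i + 1` are in the same diagram, and as zero otherwise. -/
theorem seminormalRep_average (hm : 0 < m) (hn : 0 < n) (ξ : Fin m ≃ rootsOfUnity m ℂ)
    (i : Fin (n - 1)) {j : G m n}
    (hj : ∀ X : Tableau lam,
      seminormalRep hm hn ξ lam j (tabVec X) = pContent ξ X (lo i) • tabVec X)
    (X : Tableau lam) :
    (1 / (m : ℂ)) • ∑ p ∈ Finset.Icc 1 m,
        seminormalRep hm hn ξ lam (j ^ p * sG m i * (j ^ p)⁻¹) (tabVec X) =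
      open Classical in
      if pContent ξ X (lo i) = pContent ξ X (hi i) then sOp ξ lam i (tabVec X) else 0 := by
  have hm' : (m : ℂ) ≠ 0 := Nat.cast_ne_zero.2 hm.ne'
  have hpow : ∀ (X : Tableau lam) (p : ℕ), seminormalRep hm hn ξ lam (j ^ p) (tabVec X) =
      pContent ξ X (lo i) ^ p • tabVec X := fun X p => by
    rw [map_pow, pow_tabVec (hj X)]
  -- Conjugation leaves the diagonal part of `s_i` alone and multiplies the exchanged part by the
  -- `p`-th power of a ratio of roots of unity.
  have hterm : ∀ p : ℕ, seminormalRep hm hn ξ lam (j ^ p * sG m i * (j ^ p)⁻¹) (tabVec X) =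
      invDist ξ X (lo i) (hi i) • tabVec X +
        ((pContent ξ X (hi i) / pContent ξ X (lo i)) ^ p * stepCoeff ξ i X) •
          tabVec (swapAt i X) := fun p => by
    have h0 := pow_ne_zero p (pContent_ne_zero ξ X (lo i))
    rw [map_mul, map_mul, Module.End.mul_apply, Module.End.mul_apply,
      rep_inv_apply _ h0 (hpow X p), map_smul, map_smul, seminormalRep_sG, sOp_tabVec, map_add,
      map_smul, map_smul, hpow, hpow, pContent_swapAt, Equiv.swap_apply_left, smul_add]
    simp only [smul_smul]
    congr 2
    · field_simp
    · rw [div_pow]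
      field_simp
  simp only [hterm]
  by_cases hp : pContent ξ X (lo i) = pContent ξ X (hi i)
  · rw [if_pos hp, hp, div_self (pContent_ne_zero ξ X _), sOp_tabVec]
    simp only [one_pow, one_mul, Finset.sum_const, Nat.card_Icc, Nat.add_sub_cancel]
    rw [← Nat.cast_smul_eq_nsmul ℂ, smul_smul, one_div_mul_cancel hm', one_smul]
  · have hq : (pContent ξ X (hi i) / pContent ξ X (lo i)) ^ m = 1 := by
      rw [div_pow, pContent_pow, pContent_pow, div_one]
    have hq1 : pContent ξ X (hi i) / pContent ξ X (lo i) ≠ 1 := fun h =>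
      hp (eq_of_div_eq_one h).symm
    rw [if_neg hp, invDist, if_neg hp]
    simp only [zero_smul, zero_add]
    rw [← Finset.sum_smul, ← Finset.sum_mul, sum_Icc_pow_eq_zero hq hq1]
    simp

/-- Passage from `c(X|i)` to `c(X|i+1)` under conjugation by `s_i` and the correction term. -/
theorem sOp_conj_cContent (ξ : Fin m ≃ rootsOfUnity m ℂ) (i : Fin (n - 1))
    {A : Module.End ℂ (V lam)}
    (hA : ∀ X : Tableau lam, A (tabVec X) = cContent X (lo i) • tabVec X) {X : Tableau lam}
    (hX : IsStandard X) :
    sOp ξ lam i (A (sOp ξ lam i (tabVec X))) +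
        (open Classical in
        if pContent ξ X (lo i) = pContent ξ X (hi i) then sOp ξ lam i (tabVec X) else 0) =
      cContent X (hi i) • tabVec X := by
  have hs : sOp ξ lam i (sOp ξ lam i (tabVec X)) = tabVec X := by
    rw [← Module.End.mul_apply, sOp_mul_self, Module.End.one_apply]
  -- The defect of the eigenvector equation sits at `X` and equals inverse distance times content
  -- difference: `1` in a common diagram, `0` otherwise.
  have hA' : A (sOp ξ lam i (tabVec X)) = cContent X (hi i) • sOp ξ lam i (tabVec X) -
      (open Classical in
        if pContent ξ X (lo i) = pContent ξ X (hi i) then tabVec X else 0) := by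
    rw [sOp_tabVec, map_add, map_smul, map_smul, hA, hA, cContent_swapAt, Equiv.swap_apply_left]
    by_cases hp : pContent ξ X (lo i) = pContent ξ X (hi i)
    · have hD : invDist ξ X (lo i) (hi i) * (cContent X (hi i) - cContent X (lo i)) = 1 := by
        rw [invDist, if_pos hp]
        exact one_div_mul_cancel (hX.cContent_ne ξ (lo_lt_hi i) (by simp [lo, hi]) hp)
      rw [if_pos hp]
      linear_combination (norm := module) -hD • tabVec X
    · rw [if_neg hp, invDist, if_neg hp]
      module
  rw [hA', map_sub, map_smul, hs]
  split_ifs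
  · abel
  · simp

theorem seminormalRep_jmTildeAux (hm : 0 < m) (hn : 0 < n) (ξ : Fin m ≃ rootsOfUnity m ℂ) (k : ℕ)
    (hk : k < n) (X : Tableau lam) :
    (seminormalRep hm hn ξ lam).asAlgebraHom (jmTildeAux m n k hk) (tabVec X) =
      cContent X ⟨k, hk⟩ • tabVec X := by
  by_cases hX : IsStandard X
  swap
  · simp [tabVec_of_not hX]
  induction k generalizing X with
  | zero =>
    have h0 : cContent X ⟨0, hk⟩ = 0 := by
      -- The least number sits in the corner of its diagram; otherwise the corner would carry a
      -- smaller one.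
      have hc : (X ⟨0, hk⟩).val.2 = (0, 0) := by
        obtain ⟨a, ha⟩ := exists_apply_eq X (X ⟨0, hk⟩).val.1 0 0
          ((lam.diagram _).up_left_mem (Nat.zero_le _) (Nat.zero_le _) (X ⟨0, hk⟩).property)
        by_contra hne
        have : a < ⟨0, hk⟩ := hX.lt_of_le (by rw [ha]) (by rw [ha]; exact Nat.zero_le _)
          (by rw [ha]; exact Nat.zero_le _) (by rintro rfl; rw [ha] at hne; exact hne rfl)
        exact absurd this (Nat.not_lt_zero _)
      simp [cContent, hc]
    rw [jmTildeAux, map_zero, h0, zero_smul, LinearMap.zero_apply]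
  | succ k ih =>
    have hA : ∀ X : Tableau lam,
        (seminormalRep hm hn ξ lam).asAlgebraHom (jmTildeAux m n k (by omega)) (tabVec X) =
          cContent X (lo ⟨k, by omega⟩) • tabVec X := fun Y => by
      by_cases hY : IsStandard Y
      · exact ih _ Y hY
      · simp [tabVec_of_not hY]
    have h1 := sOp_conj_cContent ξ ⟨k, by omega⟩ hA hX
    have h2 := seminormalRep_average hm hn ξ ⟨k, by omega⟩
      (fun Y => seminormalRep_jmAux hm hn ξ k (by omega) Y) X
    rw [← h2] at h1
    refine Eq.trans ?_ h1
    simp only [jmTildeAux, map_add, map_mul, map_smul, map_sum, LinearMap.add_apply,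
      LinearMap.smul_apply, LinearMap.sum_apply, Module.End.mul_apply,
      MonoidAlgebra.of_apply, Representation.asAlgebraHom_single_one, seminormalRep_sG]

/-! ### Simplicity of the joint spectrum -/

theorem basisVec_mem_jointEigenspace (hm : 0 < m) (hn : 0 < n) (ξ : Fin m ≃ rootsOfUnity m ℂ)
    (X : StdTableau lam) :
    basisVec X ∈ jointEigenspace (seminormalRep hm hn ξ lam) (contentString ξ X) := by
  rw [jointEigenspace, Submodule.mem_iInf]
  intro i
  rw [Submodule.mem_inf, Module.End.mem_eigenspace_iff, Module.End.mem_eigenspace_iff,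
    ← tabVec_of_isStandard X.property]
  constructor
  · rw [jm, MonoidAlgebra.of_apply, Representation.asAlgebraHom_single_one]
    exact seminormalRep_jmAux hm hn ξ i.val i.isLt X.val
  · exact seminormalRep_jmTildeAux hm hn ξ i.val i.isLt X.val

theorem basisVec_ne_zero (X : StdTableau lam) : basisVec X ≠ 0 := by
  simp [basisVec]

/-- A diagonal operator with respect to the standard basis acts coordinatewise. -/
theorem apply_eq_of_diagonal {ι : Type*} {A : Module.End ℂ (ι →₀ ℂ)} {d : ι → ℂ}
    (hA : ∀ x, A (Finsupp.single x 1) = d x • Finsupp.single x 1) (v : ι →₀ ℂ) (x : ι) :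
    A v x = d x * v x := by
  induction v using Finsupp.induction_linear with
  | zero => simp
  | add f g hf hg => simp [hf, hg, mul_add]
  | single y c =>
    have : Finsupp.single y c = c • Finsupp.single y (1 : ℂ) := by simp
    rw [this, map_smul, hA]
    classical
    by_cases h : y = x
    · subst h
      simp [mul_comm]
    · simp [h]

/-- All the operators are diagonal in the tableau basis, so one nonzero coordinate of a joint
eigenvector already fixes every eigenvalue. -/
theorem eq_contentString_of_mem (hm : 0 < m) (hn : 0 < n) (ξ : Fin m ≃ rootsOfUnity m ℂ)
    {L : Fin n → ℂ × ℂ} {v : V lam} (hv : v ∈ jointEigenspace (seminormalRep hm hn ξ lam) L)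
    {X : StdTableau lam} (hX : v X ≠ 0) : L = contentString ξ X := by
  rw [jointEigenspace, Submodule.mem_iInf] at hv
  have hb : ∀ (Y : StdTableau lam) i, _ := fun Y =>
    (Submodule.mem_iInf _).1 (basisVec_mem_jointEigenspace hm hn ξ Y)
  funext i
  have hvi := hv i
  rw [Submodule.mem_inf, Module.End.mem_eigenspace_iff, Module.End.mem_eigenspace_iff] at hvi
  refine Prod.ext ?_ ?_
  · have h := apply_eq_of_diagonal
      (fun Y => Module.End.mem_eigenspace_iff.1 (Submodule.mem_inf.1 (hb Y i)).1) v X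
    rw [hvi.1] at h
    exact mul_right_cancel₀ hX h
  · have h := apply_eq_of_diagonal
      (fun Y => Module.End.mem_eigenspace_iff.1 (Submodule.mem_inf.1 (hb Y i)).2) v X
    rw [hvi.2] at h
    exact mul_right_cancel₀ hX h

theorem contentString_injective (ξ : Fin m ≃ rootsOfUnity m ℂ) {X Y : StdTableau lam}
    (h : contentString ξ X = contentString ξ Y) : X = Y := by
  simpa using sigma_eq_of_contentString_eq ξ h

theorem jointSpectrum_seminormalRep (hm : 0 < m) (hn : 0 < n) (ξ : Fin m ≃ rootsOfUnity m ℂ) :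
    jointSpectrum (seminormalRep hm hn ξ lam) =
      Set.range fun X : StdTableau lam => contentString ξ X := by
  ext L
  constructor
  · rintro ⟨v, hv, hv0⟩
    obtain ⟨X, hX⟩ := Finsupp.ne_iff.1 hv0
    exact ⟨X, (eq_contentString_of_mem hm hn ξ hv hX).symm⟩
  · rintro ⟨X, rfl⟩
    exact ⟨basisVec X, basisVec_mem_jointEigenspace hm hn ξ X, basisVec_ne_zero X⟩

/-- A nonzero coordinate at another tableau would give that tableau the same content string. -/
theorem jointEigenspace_contentString (hm : 0 < m) (hn : 0 < n) (ξ : Fin m ≃ rootsOfUnity m ℂ)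
    (X : StdTableau lam) :
    jointEigenspace (seminormalRep hm hn ξ lam) (contentString ξ X) = Submodule.span ℂ {basisVec X} := by
  refine le_antisymm (fun v hv => ?_)
    ((Submodule.span_singleton_le_iff_mem _ _).2 (basisVec_mem_jointEigenspace hm hn ξ X))
  refine Submodule.mem_span_singleton.2 ⟨v X, ?_⟩
  refine Finsupp.ext fun Y => ?_
  rw [basisVec, Finsupp.smul_single_one]
  by_cases hY : X = Y
  · subst hY
    rw [Finsupp.single_eq_same]
  · have h0 : v Y = 0 := by
      by_contra h
      exact hY (contentString_injective ξ (eq_contentString_of_mem hm hn ξ hv h))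
    rw [h0, Finsupp.single_eq_of_ne (Ne.symm hY)]

end

end ClassicalJM

theorem mainTheorem11 (m n : ℕ) (hm : 0 < m) (hn : 0 < n) (ξ : Fin m ≃ rootsOfUnity m ℂ) :
    ∃ ρ : (lam : MPartition m n) → Representation ℂ (G m n) (V lam),
      (∀ lam : MPartition m n,
        ρ lam (tG m n) = tOp hn ξ lam ∧
        ∀ i : Fin (n - 1), ρ lam (sG m i) = sOp ξ lam i) ∧
      (∀ (lam : MPartition m n) (X : StdTableau lam),
        basisVec X ∈ jointEigenspace (ρ lam) (contentString ξ X)) ∧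
      (∀ lam : MPartition m n,
        jointSpectrum (ρ lam) = Set.range fun X : StdTableau lam => contentString ξ X) ∧
      (∀ lam : MPartition m n, ∀ L ∈ jointSpectrum (ρ lam),
        Module.finrank ℂ (jointEigenspace (ρ lam) L) = 1) ∧
      (∀ (lam mu : MPartition m n) (X : StdTableau lam) (Y : StdTableau mu),
        (⟨lam, X⟩ : Σ nu : MPartition m n, StdTableau nu) ≠ ⟨mu, Y⟩ →
          contentString ξ X ≠ contentString ξ Y) := by
  refine ⟨seminormalRep hm hn ξ,
    fun lam => ⟨seminormalRep_tG hm hn ξ, seminormalRep_sG hm hn ξ⟩,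
    fun lam X => basisVec_mem_jointEigenspace hm hn ξ X,
    fun lam => jointSpectrum_seminormalRep hm hn ξ, fun lam L hL => ?_,
    fun lam mu X Y hne h => hne (sigma_eq_of_contentString_eq ξ h)⟩
  rw [jointSpectrum_seminormalRep] at hL
  obtain ⟨X, rfl⟩ := hL
  rw [jointEigenspace_contentString]
  exact finrank_span_singleton (basisVec_ne_zero X)
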